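/- Let $L^2=L^2(0,1)$ (real-valued) with norm $\|\cdot\|$, and let $H^{r}=H^{r}(0,1)$ be the Sobolev space of functions whose weak derivatives of order at most $r$ lie in $L^2$. For integers $p\ge 0$, $-1\le k\le p-1$ and $n\ge 1$ let $$S_{p,k,n}=\{f\in C^k([0,1]) : f|_{[j/n,(j+1)/n)} \text{ is a polynomial of degree at most } p,\ j=0,\dots,n-1\},$$ where for $k=-1$ no continuity is required, let $\Pi_{p,k,n}$ be the $L^2$-orthogonal projection onto $S_{p,k,n}$, and let $C_{p,k,n}$ be the smallest real number such that $$\|f-\Pi_{p,k,n}f\|\le C_{p,k,n}\,\|\partial^{p+1}f\|\qquad\text{for all } f\in H^{p+1}.$$ **Theorem (IGA-DG comparison).** Let $p,n$ be positive integers such that either $n\ge 3$ and $1\le p\le 17$, or $n\ge 2$ and $p\ge 18$, and put $m=(n-1)(p+1)+1$. Then the smallest constants $C_{p,p-1,m}$ and $C_{p,-1,n}$ exist, and $$C_{p,p-1,m}<C_{p,-1,n}.$$ -/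

import Mathlib

open MeasureTheory Set
open scoped ContDiff

namespace SplineApprox

/-- Lebesgue measure on the unit interval `(0,1)`. -/
noncomputable abbrev unitMeasure : Measure ℝ := volume.restrict (Ioo (0 : ℝ) 1)

/-- The real Hilbert space `L²(0,1)`. -/
abbrev L2 : Type := Lp ℝ 2 unitMeasure

/-- `v ∈ L²(0,1)` is the weak derivative of order `r` of `u ∈ L²(0,1)` on `(0,1)`
(as an element of `L²(0,1)` it is unique if it exists). -/
def HasWeakDeriv (r : ℕ) (u v : L2) : Prop :=
  ∀ φ : ℝ → ℝ, ContDiff ℝ ∞ φ → HasCompactSupport φ → tsupport φ ⊆ Ioo (0 : ℝ) 1 →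
    ∫ x in Ioo (0 : ℝ) 1, u x * iteratedDeriv r φ x =
      (-1 : ℝ) ^ r * ∫ x in Ioo (0 : ℝ) 1, v x * φ x

/-- The Sobolev space `H^r(0,1)`: all weak derivatives of order at most `r` exist in `L²(0,1)`. -/
def sobolev (r : ℕ) : Set L2 := {u | ∀ i ≤ r, ∃ v : L2, HasWeakDeriv i u v}

/-- Functions of class `C^k` on `[0,1]`; there is no condition for `k = -1`. -/
def IsSmooth (k : ℤ) (f : ℝ → ℝ) : Prop :=
  ∀ r : ℕ, (r : ℤ) ≤ k → ContDiffOn ℝ r f (Icc (0 : ℝ) 1)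

/-- `f` is a polynomial of degree at most `p` on each `[j/n, (j+1)/n)`, `0 ≤ j < n`. -/
def IsPiecewisePoly (p n : ℕ) (f : ℝ → ℝ) : Prop :=
  ∀ j < n, ∃ P : Polynomial ℝ, P.natDegree ≤ p ∧
    ∀ x ∈ Ico ((j : ℝ) / n) (((j : ℝ) + 1) / n), f x = P.eval x

/-- The spline space of degree `p`, smoothness `k` and on `n` uniform segments of `[0,1]`,
as a subspace of `L²(0,1)`. -/
def spline (p : ℕ) (k : ℤ) (n : ℕ) : Submodule ℝ L2 where
  carrier := {u | ∃ f : ℝ → ℝ, IsSmooth k f ∧ IsPiecewisePoly p n f ∧ u =ᵐ[unitMeasure] f}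
  zero_mem' := ⟨0, fun _ _ => contDiffOn_const,
    fun _ _ => ⟨0, by simp, fun _ _ => by simp⟩, Lp.coeFn_zero _ _ _⟩
  add_mem' := by
    rintro u v ⟨f, hf, hf', huf⟩ ⟨g, hg, hg', hvg⟩
    refine ⟨f + g, fun r hr => (hf r hr).add (hg r hr), fun j hj => ?_,
      (Lp.coeFn_add u v).trans (huf.add hvg)⟩
    obtain ⟨P, hP, hfP⟩ := hf' j hj
    obtain ⟨Q, hQ, hgQ⟩ := hg' j hj
    exact ⟨P + Q, Polynomial.natDegree_add_le_of_degree_le hP hQ, fun x hx => by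
      simp [hfP x hx, hgQ x hx]⟩
  smul_mem' := by
    rintro c u ⟨f, hf, hf', huf⟩
    refine ⟨c • f, fun r hr => (hf r hr).const_smul c, fun j hj => ?_,
      (Lp.coeFn_smul c u).trans (huf.const_smul c)⟩
    obtain ⟨P, hP, hfP⟩ := hf' j hj
    exact ⟨c • P, (Polynomial.natDegree_smul_le c P).trans hP, fun x hx => by
      simp [hfP x hx]⟩

/-- The function equal to `x ^ i` on the `j`-th segment and to `0` elsewhere. -/
noncomputable def segMonomial (n j i : ℕ) : ℝ → ℝ :=
  (Ico ((j : ℝ) / n) (((j : ℝ) + 1) / n)).indicator (fun x => x ^ i)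

theorem memLp_segMonomial (n j i : ℕ) : MemLp (segMonomial n j i) 2 unitMeasure := by
  refine MemLp.indicator measurableSet_Ico ?_
  refine MemLp.of_bound (by fun_prop) 1 ?_
  refine (ae_restrict_mem measurableSet_Ioo).mono fun x hx => ?_
  rw [Real.norm_eq_abs, abs_pow, abs_of_pos hx.1]
  exact pow_le_one₀ hx.1.le hx.2.le

theorem spline_le_span (p : ℕ) (k : ℤ) (n : ℕ) [NeZero n] :
    spline p k n ≤ Submodule.span ℝ (Set.range fun a : Fin n × Fin (p + 1) =>
      (memLp_segMonomial n a.1 a.2).toLp (segMonomial n a.1 a.2)) := by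
  rintro u ⟨f, -, hf, huf⟩
  choose! P hP hfP using hf
  have hn : (0 : ℝ) < n := by exact_mod_cast Nat.pos_of_ne_zero (NeZero.ne n)
  set w : L2 := ∑ a : Fin n × Fin (p + 1), (P a.1).coeff a.2 •
    (memLp_segMonomial n a.1 a.2).toLp (segMonomial n a.1 a.2) with hw
  have hu : u = w := by
    apply Lp.ext
    have h1 : (w : ℝ → ℝ) =ᵐ[unitMeasure] fun x => ∑ a : Fin n × Fin (p + 1),
        (P a.1).coeff a.2 * segMonomial n a.1 a.2 x := by
      refine (Lp.coeFn_finsetSum _ _).trans ?_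
      have h2 : ∀ᵐ x ∂unitMeasure, ∀ a : Fin n × Fin (p + 1),
          ((P a.1).coeff a.2 • (memLp_segMonomial n a.1 a.2).toLp
            (segMonomial n a.1 a.2) : L2) x = (P a.1).coeff a.2 * segMonomial n a.1 a.2 x := by
        rw [ae_all_iff]
        intro a
        filter_upwards [Lp.coeFn_smul ((P a.1).coeff a.2)
          ((memLp_segMonomial n a.1 a.2).toLp (segMonomial n a.1 a.2)),
          (memLp_segMonomial n a.1 a.2).coeFn_toLp] with x hx hx'
        rw [hx, Pi.smul_apply, hx', smul_eq_mul]
      filter_upwards [h2] with x hx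
      simp [hx]
    filter_upwards [huf, h1, ae_restrict_mem measurableSet_Ioo] with x hx hx1 hx01
    rw [hx, hx1, Fintype.sum_prod_type]
    have hfl : (⌊x * n⌋₊ : ℝ) ≤ x * n := Nat.floor_le (mul_nonneg hx01.1.le hn.le)
    have hfl' : x * n < ⌊x * n⌋₊ + 1 := Nat.lt_floor_add_one _
    have hjn : ⌊x * n⌋₊ < n := by
      rw [Nat.floor_lt (mul_nonneg hx01.1.le hn.le)]
      nlinarith [hx01.2]
    have hmem : x ∈ Ico ((⌊x * n⌋₊ : ℝ) / n) (((⌊x * n⌋₊ : ℝ) + 1) / n) :=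
      ⟨(div_le_iff₀ hn).2 hfl, (lt_div_iff₀ hn).2 hfl'⟩
    rw [Finset.sum_eq_single (⟨⌊x * n⌋₊, hjn⟩ : Fin n)]
    · rw [hfP _ hjn x hmem, Polynomial.eval_eq_sum_range' (Nat.lt_succ_of_le (hP _ hjn)),
        Finset.sum_range]
      refine Finset.sum_congr rfl fun i _ => ?_
      simp only [segMonomial, Set.indicator_of_mem hmem]
    · intro j _ hj
      refine Finset.sum_eq_zero fun i _ => ?_
      have : x ∉ Ico (((j : ℕ) : ℝ) / n) ((((j : ℕ) : ℝ) + 1) / n) := by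
        intro h
        apply hj
        apply Fin.ext
        symm
        exact (Nat.floor_eq_iff (mul_nonneg hx01.1.le hn.le)).2
          ⟨(div_le_iff₀ hn).1 h.1, (lt_div_iff₀ hn).1 h.2⟩
      simp [segMonomial, Set.indicator_of_notMem this]
    · simp
  rw [hu, hw]
  exact Submodule.sum_mem _ fun a _ => Submodule.smul_mem _ _ (Submodule.subset_span ⟨a, rfl⟩)

/-- Spline spaces are finite-dimensional, so that the orthogonal projection onto them exists. -/
instance spline_finiteDimensional (p : ℕ) (k : ℤ) (n : ℕ) [NeZero n] :
    FiniteDimensional ℝ (spline p k n) := by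
  have := FiniteDimensional.span_of_finite ℝ (Set.finite_range
    fun a : Fin n × Fin (p + 1) => (memLp_segMonomial n a.1 a.2).toLp (segMonomial n a.1 a.2))
  exact Submodule.finiteDimensional_of_le (spline_le_span p k n)

/-- The `L²(0,1)`-orthogonal projection onto the spline space. -/
noncomputable def splineProj (p : ℕ) (k : ℤ) (n : ℕ) [NeZero n] : L2 →L[ℝ] L2 :=
  (spline p k n).starProjection

/-- The real numbers `C` such that `‖f - Π f‖ ≤ C ‖∂^(q+1) f‖` for all `f ∈ H^(q+1)(0,1)`. -/
def errorConstants (p : ℕ) (k : ℤ) (n : ℕ) [NeZero n] (q : ℕ) : Set ℝ :=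
  {C | ∀ f ∈ sobolev (q + 1), ∀ g : L2, HasWeakDeriv (q + 1) f g →
    ‖f - splineProj p k n f‖ ≤ C * ‖g‖}

/-- The smallest admissible constant for splines of degree `p` and functions in `H^(p+1)(0,1)`. -/
noncomputable def bestConst (p : ℕ) (k : ℤ) (n : ℕ) [NeZero n] : ℝ :=
  sInf (errorConstants p k n p)

end SplineApprox

/-!
Both constants are compared with explicit numbers. Write `q = p + 1`, let `h` be the length of the
segments, and let `K` be the Volterra operator `K v (x) = ∫ t in 0..x, v t` (`prim`).

*Upper bound for smooth splines.* For splines of degree `p` and smoothness `p - 1` the error is at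
most `(h / π) ^ q ‖∂^q f‖` (`norm_sub_splineProj_le`). Let `P p` be the projection onto these
splines. Since `f - K f'` is constant, and since `K` maps splines of degree `p` to splines of degree
`p + 1`, one has `(1 - P (p+1)) f = (1 - P (p+1)) K (1 - P p) f'`. By induction it is enough to bound
`(1 - P p) K` by `h / π` for every `p` (`norm_prim_sub_proj_le`). For `p = 0` this is the Poincaré
inequality with its sharp constant on each segment. The step from `p` to `p + 1` is a duality
argument: `K` is skew-adjoint up to a multiple of the projection onto constants, which are splines,
so that `(1 - P (p+1)) K (1 - P p)` and `-(1 - P p) K (1 - P (p+1))` are adjoint to each other and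
have the same norm (`norm_sub_starProjection_apply_le_of_skew`).

*Lower bound for discontinuous splines.* For `f = x ^ q` the error on each segment is the norm of a
monic polynomial of degree `q`, which is smallest for the scaled Legendre polynomial; Rodrigues'
formula gives its norm (`le_integral_eval_sq_of_monic`). As `‖∂^q f‖ = q!`, the square of the
constant is at least `q!² / ((2q)! (2q+1)!) * n ^ (-2q)` (`le_sq_of_mem_errorConstants`).

*Comparison.* With `m = (n - 1) q + 1` it remains to see that
`(2q)! (2q+1)! n ^ (2q) < q!² (π m) ^ (2q)` (`factorial_ineq`). The quotient `m / n` increases with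
`n`, so only `n = 3` with `2 ≤ q ≤ 18`, and `n = 2` with `q ≥ 19`, have to be considered. The latter
is an induction on `q`, whose step rests on `π e > 8`.
-/

namespace SplineApprox

/-! ### The Poincaré inequality on an interval -/

/-- Integration by parts for primitives of integrable functions. -/
theorem integral_primitive_mul {a b : ℝ} {u v : ℝ → ℝ} (hu : IntervalIntegrable u volume a b)
    (hv : IntervalIntegrable v volume a b) :
    ∫ x in a..b, (∫ t in a..x, u t) * v x =
      (∫ t in a..b, u t) * (∫ t in a..b, v t) - ∫ x in a..b, u x * ∫ t in a..x, v t := by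
  have hU := hu.absolutelyContinuousOnInterval_intervalIntegral (c := a) (by simp)
  have hV := hv.absolutelyContinuousOnInterval_intervalIntegral (c := a) (by simp)
  have h := hU.integral_mul_deriv_eq_deriv_mul hV
  have e1 : ∫ x in a..b, (∫ t in a..x, u t) * v x =
      ∫ x in a..b, (∫ t in a..x, u t) * deriv (fun x => ∫ t in a..x, v t) x := by
    apply intervalIntegral.integral_congr_ae
    filter_upwards [hv.ae_hasDerivAt_integral] with x hx hxI
    rw [(hx (uIoc_subset_uIcc hxI) a (by simp)).deriv]
  have e2 : ∫ x in a..b, u x * (∫ t in a..x, v t) =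
      ∫ x in a..b, deriv (fun x => ∫ t in a..x, u t) x * ∫ t in a..x, v t := by
    apply intervalIntegral.integral_congr_ae
    filter_upwards [hu.ae_hasDerivAt_integral] with x hx hxI
    rw [(hx (uIoc_subset_uIcc hxI) a (by simp)).deriv]
  rw [e1, e2, h]
  simp

/-- Wirtinger's inequality for functions vanishing at both ends, with any frequency `l` below the
critical one. The integrand `G'² - l² G²` is the square `(G' - c G)²` up to the derivative of
`c G²`, where `c = -l tan (l (x - (a + b) / 2))` solves `c' = -l² - c²`. -/
theorem sq_mul_integral_sq_le_of_lt {a b : ℝ} (hab : a < b) {G g : ℝ → ℝ}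
    (hG : ContinuousOn G (Icc a b)) (hg : ContinuousOn g (Icc a b))
    (hd : ∀ x ∈ Ioo a b, HasDerivAt G (g x) x) (ha : G a = 0) (hb : G b = 0)
    {l : ℝ} (hl0 : 0 < l) (hl : l * (b - a) < Real.pi) :
    l ^ 2 * ∫ x in a..b, G x ^ 2 ≤ ∫ x in a..b, g x ^ 2 := by
  set s : ℝ → ℝ := fun x => l * (x - (a + b) / 2) with hs
  have hcos : ∀ x ∈ Icc a b, Real.cos (s x) ≠ 0 := by
    intro x hx
    apply ne_of_gt
    apply Real.cos_pos_of_mem_Ioo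
    constructor
    · simp only [hs]; nlinarith [hx.1, hx.2]
    · simp only [hs]; nlinarith [hx.1, hx.2]
  set c : ℝ → ℝ := fun x => -l * Real.tan (s x) with hc
  have hcd : ∀ x ∈ Icc a b, HasDerivAt c (-l ^ 2 - c x ^ 2) x := by
    intro x hx
    have h1 : HasDerivAt s l x := by
      simpa using ((hasDerivAt_id x).sub_const ((a + b) / 2)).const_mul l
    have h2 := ((Real.hasDerivAt_tan (hcos x hx)).comp x h1).const_mul (-l)
    convert! h2 using 1
    simp only [hc, Real.tan_eq_sin_div_cos]
    have := Real.sin_sq_add_cos_sq (s x)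
    have h0 := hcos x hx
    field_simp
    linear_combination -this
  have hcc : ContinuousOn c (Icc a b) := fun x hx => (hcd x hx).continuousAt.continuousWithinAt
  have hle := hab.le
  have hu : uIcc a b = Icc a b := uIcc_of_le hle
  have key : ∫ x in a..b, ((-l ^ 2 - c x ^ 2) * G x ^ 2 + c x * (2 * G x * g x)) = 0 := by
    rw [intervalIntegral.integral_eq_sub_of_hasDerivAt_of_le hle
      (f := fun x => c x * G x ^ 2) (hcc.mul (hG.pow 2))]
    · simp [ha, hb]
    · intro x hx
      have := (hcd x (Ioo_subset_Icc_self hx)).mul ((hd x hx).pow 2)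
      convert! this using 1
      simp
    · apply ContinuousOn.intervalIntegrable
      rw [hu]
      fun_prop
  have hi1 : IntervalIntegrable (fun x => G x ^ 2) volume a b :=
    (hG.pow 2).intervalIntegrable_of_Icc hle
  have hi2 : IntervalIntegrable (fun x => g x ^ 2) volume a b :=
    (hg.pow 2).intervalIntegrable_of_Icc hle
  have hi3 : IntervalIntegrable (fun x => (-l ^ 2 - c x ^ 2) * G x ^ 2 + c x * (2 * G x * g x))
      volume a b := by
    apply ContinuousOn.intervalIntegrable
    rw [hu]
    fun_prop
  have h0 : 0 ≤ ∫ x in a..b, (g x - c x * G x) ^ 2 :=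
    intervalIntegral.integral_nonneg hle fun x _ => sq_nonneg _
  have e : ∫ x in a..b, (g x - c x * G x) ^ 2 = (∫ x in a..b, g x ^ 2) -
      l ^ 2 * (∫ x in a..b, G x ^ 2) -
      ∫ x in a..b, ((-l ^ 2 - c x ^ 2) * G x ^ 2 + c x * (2 * G x * g x)) := by
    rw [← intervalIntegral.integral_const_mul,
      ← intervalIntegral.integral_sub hi2 (hi1.const_mul _),
      ← intervalIntegral.integral_sub (hi2.sub (hi1.const_mul _)) hi3]
    congr 1
    ext x
    ring
  rw [key] at e
  linarith

/-- Wirtinger's inequality for functions vanishing at both ends. -/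
theorem integral_sq_le_of_boundary_zero {a b : ℝ} (hab : a < b) {G g : ℝ → ℝ}
    (hG : ContinuousOn G (Icc a b)) (hg : ContinuousOn g (Icc a b))
    (hd : ∀ x ∈ Ioo a b, HasDerivAt G (g x) x) (ha : G a = 0) (hb : G b = 0) :
    (Real.pi / (b - a)) ^ 2 * ∫ x in a..b, G x ^ 2 ≤ ∫ x in a..b, g x ^ 2 := by
  have h0 : 0 < Real.pi / (b - a) := div_pos Real.pi_pos (sub_pos.2 hab)
  have hev : ∀ᶠ l in nhdsWithin (Real.pi / (b - a)) (Iio (Real.pi / (b - a))),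
      l ^ 2 * ∫ x in a..b, G x ^ 2 ≤ ∫ x in a..b, g x ^ 2 := by
    filter_upwards [Ioo_mem_nhdsLT h0] with l hl
    exact sq_mul_integral_sq_le_of_lt hab hG hg hd ha hb hl.1
      ((lt_div_iff₀ (sub_pos.2 hab)).1 hl.2)
  refine le_of_tendsto (f := fun l : ℝ => l ^ 2 * ∫ x in a..b, G x ^ 2) ?_ hev
  have : Continuous fun l : ℝ => l ^ 2 * ∫ x in a..b, G x ^ 2 := by fun_prop
  exact (this.tendsto _).mono_left nhdsWithin_le_nhds

/-- The Poincaré inequality with its sharp constant, on an interval: a primitive `U` of `v` differs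
from its mean value by at most `(b - a) / π` times the norm of `v`. It is dual to Wirtinger's
inequality, applied to the primitive of `U` minus its mean. -/
theorem exists_integral_sub_const_sq_le {a b : ℝ} (hab : a < b) {U v : ℝ → ℝ}
    (hv : IntervalIntegrable v volume a b)
    (hv2 : IntervalIntegrable (fun x => v x ^ 2) volume a b)
    (hU : ∀ x ∈ Icc a b, U x = U a + ∫ t in a..x, v t) :
    ∃ c : ℝ, ∫ x in a..b, (U x - c) ^ 2 ≤ ((b - a) / Real.pi) ^ 2 * ∫ x in a..b, v x ^ 2 := by
  have hle := hab.le
  have hu : uIcc a b = Icc a b := uIcc_of_le hle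
  have hba : 0 < b - a := sub_pos.2 hab
  have hV : ContinuousOn (fun x => ∫ t in a..x, v t) (Icc a b) := by
    rw [← hu]
    exact (hv.absolutelyContinuousOnInterval_intervalIntegral (c := a) (by simp)).continuousOn
  have hUc : ContinuousOn U (Icc a b) :=
    (continuousOn_const.add hV).congr fun x hx => hU x hx
  set c : ℝ := (∫ x in a..b, U x) / (b - a) with hc
  refine ⟨c, ?_⟩
  set g : ℝ → ℝ := fun x => U x - c with hgdef
  have hg : ContinuousOn g (Icc a b) := hUc.sub continuousOn_const
  have hgi : IntervalIntegrable g volume a b := hg.intervalIntegrable_of_Icc hle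
  have hg0 : ∫ x in a..b, g x = 0 := by
    simp only [hgdef]
    rw [intervalIntegral.integral_sub (hUc.intervalIntegrable_of_Icc hle) (by simp)]
    simp only [intervalIntegral.integral_const, smul_eq_mul, hc]
    field_simp
    ring
  set G : ℝ → ℝ := fun x => ∫ t in a..x, g t with hGdef
  have hG : ContinuousOn G (Icc a b) := by
    rw [← hu]
    exact (hgi.absolutelyContinuousOnInterval_intervalIntegral (c := a) (by simp)).continuousOn
  have hGd : ∀ x ∈ Ioo a b, HasDerivAt G (g x) x := by
    intro x hx
    have hx' : Icc a b ∈ nhds x := Icc_mem_nhds hx.1 hx.2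
    refine intervalIntegral.integral_hasDerivAt_right ?_ ?_ (hg.continuousAt hx')
    · exact (hg.mono (Icc_subset_Icc_right hx.2.le)).intervalIntegrable_of_Icc hx.1.le
    · exact ⟨Icc a b, hx', hg.aestronglyMeasurable measurableSet_Icc⟩
  have hW := integral_sq_le_of_boundary_zero hab hG hg hGd (by simp [hGdef]) (by simp [hGdef, hg0])
  have hparts := integral_primitive_mul hgi hv
  rw [hg0, zero_mul, zero_sub] at hparts
  have hgV : ∫ x in a..b, g x * ∫ t in a..x, v t = ∫ x in a..b, g x ^ 2 := by
    have e : ∫ x in a..b, g x * ∫ t in a..x, v t =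
        ∫ x in a..b, (g x ^ 2 + (c - U a) * g x) := by
      apply intervalIntegral.integral_congr
      intro x hx
      rw [hu] at hx
      have := hU x hx
      simp only [hgdef]
      rw [show ∫ t in a..x, v t = U x - U a by linarith]
      ring
    have hg2 : IntervalIntegrable (fun x => g x ^ 2) volume a b :=
      (hg.pow 2).intervalIntegrable_of_Icc hle
    rw [e, intervalIntegral.integral_add hg2 (hgi.const_mul _),
      intervalIntegral.integral_const_mul, hg0]
    ring
  rw [hgV] at hparts
  set k : ℝ := (Real.pi / (b - a)) ^ 2 with hk
  have hk0 : 0 < k := pow_pos (div_pos Real.pi_pos hba) 2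
  have hk' : ((b - a) / Real.pi) ^ 2 = k⁻¹ := by rw [hk, ← inv_pow, inv_div]
  have hGv : IntervalIntegrable (fun x => G x * v x) volume a b :=
    hv.continuousOn_mul (by rwa [hu])
  have hG2 : IntervalIntegrable (fun x => G x ^ 2) volume a b :=
    (hG.pow 2).intervalIntegrable_of_Icc hle
  have h1 : -(∫ x in a..b, G x * v x) ≤
      k / 2 * (∫ x in a..b, G x ^ 2) + k⁻¹ / 2 * ∫ x in a..b, v x ^ 2 := by
    rw [← intervalIntegral.integral_neg, ← intervalIntegral.integral_const_mul,
      ← intervalIntegral.integral_const_mul,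
      ← intervalIntegral.integral_add (hG2.const_mul _) (hv2.const_mul _)]
    refine intervalIntegral.integral_mono_on hle hGv.neg
      ((hG2.const_mul _).add (hv2.const_mul _)) fun x _ => ?_
    have : k / 2 * G x ^ 2 + k⁻¹ / 2 * v x ^ 2 + G x * v x = k⁻¹ / 2 * (k * G x + v x) ^ 2 := by
      field_simp
      ring
    have h2 : 0 ≤ k⁻¹ / 2 * (k * G x + v x) ^ 2 := by positivity
    linarith
  rw [hk']
  have hparts' : ∫ x in a..b, G x * v x = -∫ x in a..b, g x ^ 2 := hparts
  linarith

/-! ### Integrals over the unit interval -/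

theorem setIntegral_Ioo_eq_intervalIntegral (f : ℝ → ℝ) :
    ∫ x in Ioo (0 : ℝ) 1, f x = ∫ x in (0 : ℝ)..1, f x := by
  rw [intervalIntegral.integral_of_le zero_le_one, integral_Ioc_eq_integral_Ioo]

theorem intervalIntegrable_iff_integrable_unitMeasure {f : ℝ → ℝ} :
    IntervalIntegrable f volume 0 1 ↔ Integrable f unitMeasure := by
  rw [intervalIntegrable_iff_integrableOn_Ioo_of_le zero_le_one, IntegrableOn]

theorem memLp_of_continuousOn {f : ℝ → ℝ} (hf : ContinuousOn f (Icc 0 1)) :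
    MemLp f 2 unitMeasure := by
  obtain ⟨C, hC⟩ := isCompact_Icc.exists_bound_of_continuousOn hf
  refine MemLp.of_bound
    ((hf.mono Ioo_subset_Icc_self).aestronglyMeasurable measurableSet_Ioo) C ?_
  exact (ae_restrict_mem measurableSet_Ioo).mono fun x hx => hC x (Ioo_subset_Icc_self hx)

theorem intervalIntegrable_coe (v : L2) : IntervalIntegrable v volume 0 1 :=
  intervalIntegrable_iff_integrable_unitMeasure.2 ((Lp.memLp v).integrable (by norm_num))

theorem intervalIntegrable_coe_sq (v : L2) :
    IntervalIntegrable (fun x => v x ^ 2) volume 0 1 :=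
  intervalIntegrable_iff_integrable_unitMeasure.2 (Lp.memLp v).integrable_sq

theorem inner_eq_integral (u v : L2) : inner ℝ u v = ∫ x in (0 : ℝ)..1, u x * v x := by
  rw [L2.inner_def, ← setIntegral_Ioo_eq_intervalIntegral]
  congr 1
  ext x
  simp [mul_comm]

theorem norm_sq_eq_integral (u : L2) : ‖u‖ ^ 2 = ∫ x in (0 : ℝ)..1, u x ^ 2 := by
  rw [← real_inner_self_eq_norm_sq, inner_eq_integral]
  congr 1
  ext x
  ring

theorem intervalIntegral_congr_ae_unit {f g : ℝ → ℝ} (h : f =ᵐ[unitMeasure] g) :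
    ∫ x in (0 : ℝ)..1, f x = ∫ x in (0 : ℝ)..1, g x := by
  rw [← setIntegral_Ioo_eq_intervalIntegral, ← setIntegral_Ioo_eq_intervalIntegral]
  exact integral_congr_ae h

theorem primitive_congr_ae {f g : ℝ → ℝ} (h : f =ᵐ[unitMeasure] g) {x : ℝ}
    (hx : x ∈ Icc (0 : ℝ) 1) :
    ∫ t in (0 : ℝ)..x, f t = ∫ t in (0 : ℝ)..x, g t := by
  rw [intervalIntegral.integral_of_le hx.1, intervalIntegral.integral_of_le hx.1,
    integral_Ioc_eq_integral_Ioo, integral_Ioc_eq_integral_Ioo]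
  exact integral_congr_ae (h.filter_mono (ae_mono (Measure.restrict_mono
    (Ioo_subset_Ioo_right hx.2) le_rfl)))

/-! ### The Volterra operator -/

theorem continuousOn_primitive_coe (v : L2) :
    ContinuousOn (fun x => ∫ t in (0 : ℝ)..x, v t) (Icc 0 1) := by
  have := ((intervalIntegrable_coe v).absolutelyContinuousOnInterval_intervalIntegral
    (c := 0) (by simp)).continuousOn
  rwa [uIcc_of_le zero_le_one] at this

/-- The primitive vanishing at `0`, as an operator on `L²(0,1)` (the Volterra operator). -/
noncomputable def prim (v : L2) : L2 :=
  (memLp_of_continuousOn (continuousOn_primitive_coe v)).toLp (fun x => ∫ t in (0 : ℝ)..x, v t)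

theorem coeFn_prim (v : L2) : prim v =ᵐ[unitMeasure] fun x => ∫ t in (0 : ℝ)..x, v t :=
  MemLp.coeFn_toLp _

/-- The constant function with value `c`, as an element of `L²(0,1)`. -/
noncomputable def constL2 (c : ℝ) : L2 := (memLp_const c).toLp (fun _ => c)

theorem coeFn_constL2 (c : ℝ) : constL2 c =ᵐ[unitMeasure] fun _ => c := MemLp.coeFn_toLp _

theorem prim_add (u v : L2) : prim (u + v) = prim u + prim v := by
  apply Lp.ext
  filter_upwards [coeFn_prim (u + v), coeFn_prim u, coeFn_prim v, Lp.coeFn_add (prim u) (prim v),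
    ae_restrict_mem measurableSet_Ioo] with x h1 h2 h3 h4 hx
  rw [h1, h4, Pi.add_apply, h2, h3, primitive_congr_ae (Lp.coeFn_add u v) (Ioo_subset_Icc_self hx)]
  have hs : uIcc 0 x ⊆ uIcc (0 : ℝ) 1 := by
    rw [uIcc_of_le hx.1.le, uIcc_of_le zero_le_one]
    exact Icc_subset_Icc_right hx.2.le
  exact intervalIntegral.integral_add ((intervalIntegrable_coe u).mono_set hs)
    ((intervalIntegrable_coe v).mono_set hs)

/-- The adjoint of the Volterra operator is its negative, up to an operator of rank one. -/
theorem inner_prim_add_inner_prim (u v : L2) :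
    inner ℝ (prim u) v + inner ℝ u (prim v) =
      inner ℝ u (constL2 1) * inner ℝ v (constL2 1) := by
  have h1 : inner ℝ (prim u) v = ∫ x in (0 : ℝ)..1, (∫ t in (0 : ℝ)..x, u t) * v x := by
    rw [inner_eq_integral]
    refine intervalIntegral_congr_ae_unit ?_
    filter_upwards [coeFn_prim u] with x hx
    rw [hx]
  have h2 : inner ℝ u (prim v) = ∫ x in (0 : ℝ)..1, u x * ∫ t in (0 : ℝ)..x, v t := by
    rw [inner_eq_integral]
    refine intervalIntegral_congr_ae_unit ?_
    filter_upwards [coeFn_prim v] with x hx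
    rw [hx]
  have h3 : ∀ w : L2, inner ℝ w (constL2 1) = ∫ x in (0 : ℝ)..1, w x := by
    intro w
    rw [inner_eq_integral]
    refine intervalIntegral_congr_ae_unit ?_
    filter_upwards [coeFn_constL2 1] with x hx
    rw [hx, mul_one]
  rw [h1, h2, h3, h3, integral_primitive_mul (intervalIntegrable_coe u) (intervalIntegrable_coe v)]
  ring

/-! ### Best approximation by subspaces -/

section Hilbert

variable {E : Type*} [NormedAddCommGroup E] [InnerProductSpace ℝ E]

theorem norm_sub_starProjection_le (S : Submodule ℝ E) [S.HasOrthogonalProjection] (v : E) {s : E}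
    (hs : s ∈ S) : ‖v - S.starProjection v‖ ≤ ‖v - s‖ := by
  rw [S.starProjection_minimal v]
  exact ciInf_le ⟨0, by rintro _ ⟨x, rfl⟩; positivity⟩ (⟨s, hs⟩ : S)

theorem sub_starProjection_add (S : Submodule ℝ E) [S.HasOrthogonalProjection] (v : E) {s : E}
    (hs : s ∈ S) : s + v - S.starProjection (s + v) = v - S.starProjection v := by
  rw [map_add, Submodule.starProjection_eq_self_iff.2 hs]
  abel

/-- An error estimate for `K v` passes from a subspace `T` to a subspace `S ⊇ K T` if `K` is
skew-adjoint up to a rank one operator whose range lies in `T`: with `P`, `Q` the projections onto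
`T` and `S`, the operators `(1 - Q) K (1 - P)` and `-(1 - P) K (1 - Q)` are adjoint to each
other. -/
theorem norm_sub_starProjection_apply_le_of_skew (S T : Submodule ℝ E) [S.HasOrthogonalProjection]
    [T.HasOrthogonalProjection] (K : E → E) (hadd : ∀ u v, K (u + v) = K u + K v)
    (hK : ∀ v ∈ T, K v ∈ S) {e : E} (he : e ∈ T)
    (hskew : ∀ u v, inner ℝ (K u) v + inner ℝ u (K v) = inner ℝ u e * inner ℝ v e) {c : ℝ}
    (hc : 0 ≤ c) (hT : ∀ v, ‖K v - T.starProjection (K v)‖ ≤ c * ‖v‖) (v : E) :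
    ‖K v - S.starProjection (K v)‖ ≤ c * ‖v‖ := by
  set v' := v - T.starProjection v with hv'
  set w := K v - S.starProjection (K v) with hw
  have horth : ∀ s ∈ S, inner ℝ w s = 0 := fun s hs => S.starProjection_inner_eq_zero _ s hs
  have hortho' : ∀ t ∈ T, inner ℝ v' t = 0 := fun t ht => T.starProjection_inner_eq_zero _ t ht
  have h1 : ‖w‖ ^ 2 = inner ℝ w (K v') := by
    have hK1 : K v = K v' + K (T.starProjection v) := by
      rw [← hadd, hv', sub_add_cancel]
    calc ‖w‖ ^ 2 = inner ℝ w (K v - S.starProjection (K v)) := (real_inner_self_eq_norm_sq w).symm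
      _ = inner ℝ w (K v') := by
        rw [inner_sub_right w, horth _ (S.starProjection_apply_mem _), hK1, inner_add_right,
          horth _ (hK _ (T.starProjection_apply_mem v))]
        ring
  have h2 : inner ℝ w (K v') = -inner ℝ (K w - T.starProjection (K w)) v' := by
    have := hskew w v'
    rw [hortho' e he, mul_zero] at this
    rw [inner_sub_left (K w), real_inner_comm v' (T.starProjection (K w)),
      hortho' _ (T.starProjection_apply_mem _)]
    linarith
  have h3 : ‖v'‖ ≤ ‖v‖ := by
    simpa using norm_sub_starProjection_le T v (Submodule.zero_mem T)
  have h4 : ‖w‖ ^ 2 ≤ (c * ‖w‖) * ‖v‖ := by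
    rw [h1, h2, ← inner_neg_left]
    refine (real_inner_le_norm _ _).trans ?_
    rw [norm_neg]
    exact mul_le_mul (hT w) h3 (norm_nonneg _) (by positivity)
  rcases (norm_nonneg w).eq_or_lt with h0 | h0
  · rw [← h0]; positivity
  · refine le_of_mul_le_mul_left ?_ h0
    linarith

end Hilbert

/-! ### Smooth splines -/

theorem constL2_mem_spline (p : ℕ) (k : ℤ) (n : ℕ) (c : ℝ) : constL2 c ∈ spline p k n :=
  ⟨fun _ => c, fun _ _ => contDiffOn_const, fun _ _ => ⟨Polynomial.C c, by simp, by simp⟩,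
    coeFn_constL2 c⟩

theorem contDiffOn_primitive {f : ℝ → ℝ} {r : ℕ} (hf : ContDiffOn ℝ r f (Icc 0 1)) :
    ContDiffOn ℝ (r + 1 : ℕ) (fun x => ∫ t in (0 : ℝ)..x, f t) (Icc 0 1) := by
  have hc := hf.continuousOn
  have hd : ∀ x ∈ Icc (0 : ℝ) 1,
      HasDerivWithinAt (fun x => ∫ t in (0 : ℝ)..x, f t) (f x) (Icc 0 1) x := by
    intro x hx
    have : Fact (x ∈ Icc (0 : ℝ) 1) := ⟨hx⟩
    refine intervalIntegral.integral_hasDerivWithinAt_right (s := Icc 0 1) (t := Icc 0 1) ?_ ?_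
      (hc x hx)
    · exact (hc.mono (Icc_subset_Icc_right hx.2)).intervalIntegrable_of_Icc hx.1
    · exact ⟨Icc 0 1, self_mem_nhdsWithin, hc.aestronglyMeasurable measurableSet_Icc⟩
  push_cast
  rw [contDiffOn_succ_iff_derivWithin (uniqueDiffOn_Icc zero_lt_one)]
  refine ⟨fun x hx => (hd x hx).differentiableWithinAt, by simp, hf.congr fun x hx => ?_⟩
  exact (hd x hx).derivWithin (uniqueDiffOn_Icc zero_lt_one x hx)

theorem exists_derivative_eq (P : Polynomial ℝ) {p : ℕ} (hP : P.natDegree ≤ p) :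
    ∃ Q : Polynomial ℝ, Q.natDegree ≤ p + 1 ∧ Q.derivative = P := by
  refine ⟨∑ i ∈ Finset.range (p + 1), Polynomial.monomial (i + 1) (P.coeff i / (i + 1)), ?_, ?_⟩
  · refine Polynomial.natDegree_sum_le_of_forall_le _ _ fun i hi => ?_
    exact (Polynomial.natDegree_monomial_le _).trans (by simpa using Finset.mem_range.1 hi)
  · conv_rhs => rw [P.as_sum_range' (p + 1) (by omega)]
    rw [Polynomial.derivative_sum]
    refine Finset.sum_congr rfl fun i _ => ?_
    rw [Polynomial.derivative_monomial]
    congr 1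
    have : (i : ℝ) + 1 ≠ 0 := by positivity
    push_cast
    field_simp

/-- Integration raises both the degree and the smoothness of a spline by one. -/
theorem prim_mem_spline {p n : ℕ} [NeZero n] {v : L2} (hv : v ∈ spline p ((p : ℤ) - 1) n) :
    prim v ∈ spline (p + 1) (((p + 1 : ℕ) : ℤ) - 1) n := by
  obtain ⟨f, hf, hfp, hvf⟩ := hv
  have hn : (0 : ℝ) < n := by exact_mod_cast Nat.pos_of_ne_zero (NeZero.ne n)
  refine ⟨fun x => ∫ t in (0 : ℝ)..x, v t, ?_, ?_, coeFn_prim v⟩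
  · intro r hr
    rcases r with _ | r
    · rw [Nat.cast_zero, contDiffOn_zero]
      exact continuousOn_primitive_coe v
    · refine (contDiffOn_primitive (hf r (by push_cast at hr ⊢; linarith))).congr fun x hx => ?_
      exact primitive_congr_ae hvf hx
  · intro j hj
    obtain ⟨P, hP, hfP⟩ := hfp j hj
    obtain ⟨Q, hQ, hQP⟩ := exists_derivative_eq P hP
    set a : ℝ := (j : ℝ) / n with ha
    refine ⟨Q + Polynomial.C ((∫ t in (0 : ℝ)..a, v t) - Q.eval a), ?_, ?_⟩
    · rw [Polynomial.natDegree_add_C]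
      exact hQ
    · intro x hx
      have ha0 : 0 ≤ a := by positivity
      have hb1 : ((j : ℝ) + 1) / n ≤ 1 := by
        rw [div_le_one hn]
        exact_mod_cast hj
      have hx1 : x ≤ 1 := hx.2.le.trans hb1
      have hs : ∀ y z : ℝ, 0 ≤ y → y ≤ z → z ≤ 1 → uIcc y z ⊆ uIcc (0 : ℝ) 1 := by
        intro y z h1 h2 h3
        rw [uIcc_of_le h2, uIcc_of_le zero_le_one]
        exact Icc_subset_Icc h1 h3
      have hvi := intervalIntegrable_coe v
      have hax : ∫ t in a..x, v t = ∫ t in a..x, P.eval t := by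
        rw [intervalIntegral.integral_of_le hx.1, intervalIntegral.integral_of_le hx.1,
          integral_Ioc_eq_integral_Ioo, integral_Ioc_eq_integral_Ioo]
        have h1 : ∀ᵐ t ∂(volume.restrict (Ioo a x)), v t = f t :=
          hvf.filter_mono (ae_mono (Measure.restrict_mono (Ioo_subset_Ioo ha0 hx1) le_rfl))
        refine integral_congr_ae ?_
        filter_upwards [h1, ae_restrict_mem measurableSet_Ioo] with t ht htI
        rw [ht, hfP t ⟨htI.1.le, htI.2.trans hx.2⟩]
      beta_reduce
      rw [← intervalIntegral.integral_add_adjacent_intervals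
        (hvi.mono_set (hs 0 a le_rfl ha0 (hx.1.trans hx1))) (hvi.mono_set (hs a x ha0 hx.1 hx1)),
        hax, intervalIntegral.integral_eq_sub_of_hasDerivAt (f := fun t => Q.eval t)
          (fun t _ => by rw [← hQP]; exact Q.hasDerivAt t)
          (P.continuous.intervalIntegrable _ _)]
      simp
      ring

/-! ### Primitives and piecewise constant functions -/

theorem segment_subset {n j : ℕ} (hj : j < n) :
    Icc ((j : ℝ) / n) (((j : ℝ) + 1) / n) ⊆ Icc (0 : ℝ) 1 := by
  have hn : (0 : ℝ) < n := by exact_mod_cast (Nat.zero_le j).trans_lt hj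
  refine Icc_subset_Icc (by positivity) ?_
  rw [div_le_one hn]
  exact_mod_cast hj

theorem segment_lt {n : ℕ} (hn : 0 < n) (j : ℕ) : (j : ℝ) / n < ((j : ℝ) + 1) / n := by
  have : (0 : ℝ) < n := by exact_mod_cast hn
  gcongr
  linarith

theorem intervalIntegrable_segment {n j : ℕ} (hj : j < n) {g : ℝ → ℝ}
    (hg : IntervalIntegrable g volume 0 1) :
    IntervalIntegrable g volume ((j : ℝ) / n) (((j : ℝ) + 1) / n) := by
  refine hg.mono_set ?_
  rw [uIcc_of_le (segment_lt (by omega) j).le, uIcc_of_le zero_le_one]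
  exact segment_subset hj

theorem integral_unit_eq_sum_segments {n : ℕ} (hn : 0 < n) {g : ℝ → ℝ}
    (hg : IntervalIntegrable g volume 0 1) :
    ∫ x in (0 : ℝ)..1, g x =
      ∑ j ∈ Finset.range n, ∫ x in ((j : ℝ) / n)..(((j : ℝ) + 1) / n), g x := by
  have h := intervalIntegral.sum_integral_adjacent_intervals (μ := volume) (f := g)
    (a := fun k : ℕ => (k : ℝ) / n) (n := n) (fun k hk => by
      simpa using intervalIntegrable_segment hk hg)
  have hn' : (n : ℝ) ≠ 0 := by positivity
  simp only [Nat.cast_zero, zero_div, div_self hn'] at h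
  rw [← h]
  simp

theorem integral_congr_Ioo {a b : ℝ} (hab : a ≤ b) {f g : ℝ → ℝ} (h : ∀ x ∈ Ioo a b, f x = g x) :
    ∫ x in a..b, f x = ∫ x in a..b, g x := by
  rw [intervalIntegral.integral_of_le hab, intervalIntegral.integral_of_le hab,
    integral_Ioc_eq_integral_Ioo, integral_Ioc_eq_integral_Ioo]
  exact setIntegral_congr_fun measurableSet_Ioo h

theorem floor_mul_eq {n j : ℕ} (hn : 0 < n) {x : ℝ}
    (hx : x ∈ Ico ((j : ℝ) / n) (((j : ℝ) + 1) / n)) : ⌊x * n⌋₊ = j := by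
  have hn' : (0 : ℝ) < n := by exact_mod_cast hn
  have h0 : 0 ≤ x := le_trans (by positivity) hx.1
  exact (Nat.floor_eq_iff (mul_nonneg h0 hn'.le)).2
    ⟨(div_le_iff₀ hn').1 hx.1, (lt_div_iff₀ hn').1 hx.2⟩

theorem memLp_step (n : ℕ) (c : ℕ → ℝ) : MemLp (fun x : ℝ => c ⌊x * n⌋₊) 2 unitMeasure := by
  refine MemLp.of_bound ?_ (∑ j ∈ Finset.range (n + 1), |c j|) ?_
  · exact (measurable_from_nat.comp
      (Nat.measurable_floor.comp (measurable_id.mul_const _))).aestronglyMeasurable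
  · refine (ae_restrict_mem measurableSet_Ioo).mono fun x hx => ?_
    have : ⌊x * n⌋₊ ∈ Finset.range (n + 1) := by
      rw [Finset.mem_range, Nat.lt_succ_iff]
      exact Nat.floor_le_of_le (by nlinarith [hx.2, Nat.cast_nonneg (α := ℝ) n])
    exact Finset.single_le_sum (f := fun j => |c j|) (fun _ _ => abs_nonneg _) this

/-- The Poincaré inequality on each segment bounds the distance of a primitive to the piecewise
constant functions. -/
theorem norm_prim_sub_proj_zero_le (n : ℕ) [NeZero n] (v : L2) :
    ‖prim v - splineProj 0 (((0 : ℕ) : ℤ) - 1) n (prim v)‖ ≤ 1 / (Real.pi * n) * ‖v‖ := by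
  have hn : 0 < n := Nat.pos_of_ne_zero (NeZero.ne n)
  have hn' : (0 : ℝ) < n := by exact_mod_cast hn
  set U : ℝ → ℝ := fun x => ∫ t in (0 : ℝ)..x, v t with hU
  have hvi := intervalIntegrable_coe v
  have hseg : ∀ j < n, ∃ c : ℝ, ∫ x in ((j : ℝ) / n)..(((j : ℝ) + 1) / n), (U x - c) ^ 2 ≤
      (1 / (Real.pi * n)) ^ 2 * ∫ x in ((j : ℝ) / n)..(((j : ℝ) + 1) / n), v x ^ 2 := by
    intro j hj
    obtain ⟨c, hc⟩ := exists_integral_sub_const_sq_le (segment_lt hn j) (U := U)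
      (intervalIntegrable_segment hj hvi)
      (intervalIntegrable_segment hj (intervalIntegrable_coe_sq v)) (fun x hx => by
        have h0 : ∀ z ∈ Icc (0 : ℝ) 1, uIcc 0 z ⊆ uIcc (0 : ℝ) 1 := fun z hz => by
          rw [uIcc_of_le hz.1, uIcc_of_le zero_le_one]
          exact Icc_subset_Icc_right hz.2
        have h1 := hvi.mono_set (h0 _ (segment_subset hj (left_mem_Icc.2 (segment_lt hn j).le)))
        have h2 := hvi.mono_set (h0 _ (segment_subset hj hx))
        exact (intervalIntegral.integral_add_adjacent_intervals h1 (h1.symm.trans h2)).symm)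
    refine ⟨c, hc.trans_eq ?_⟩
    congr 2
    field_simp
    ring
  choose! c hc using hseg
  set s : L2 := (memLp_step n c).toLp _ with hs
  have hsc : s =ᵐ[unitMeasure] fun x => c ⌊x * n⌋₊ := MemLp.coeFn_toLp _
  have hmem : s ∈ spline 0 (((0 : ℕ) : ℤ) - 1) n := by
    refine ⟨fun x => c ⌊x * n⌋₊, fun r hr => by omega, fun j hj => ?_, hsc⟩
    refine ⟨Polynomial.C (c j), by simp, fun x hx => ?_⟩
    simp [floor_mul_eq hn hx]
  refine (norm_sub_starProjection_le _ _ hmem).trans ?_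
  refine le_of_sq_le_sq ?_ (by positivity)
  have hae : (fun x => (prim v - s : L2) x ^ 2) =ᵐ[unitMeasure]
      fun x => (U x - c ⌊x * n⌋₊) ^ 2 := by
    filter_upwards [Lp.coeFn_sub (prim v) s, coeFn_prim v, hsc] with x h1 h2 h3
    rw [h1, Pi.sub_apply, h2, h3]
  have hint : IntervalIntegrable (fun x => (U x - c ⌊x * n⌋₊) ^ 2) volume 0 1 :=
    intervalIntegrable_iff_integrable_unitMeasure.2
      ((intervalIntegrable_iff_integrable_unitMeasure.1
        (intervalIntegrable_coe_sq (prim v - s))).congr hae)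
  rw [mul_pow, norm_sq_eq_integral, norm_sq_eq_integral v, intervalIntegral_congr_ae_unit hae,
    integral_unit_eq_sum_segments hn hint,
    integral_unit_eq_sum_segments hn (intervalIntegrable_coe_sq v), Finset.mul_sum]
  refine Finset.sum_le_sum fun j hj => ?_
  refine (hc j (Finset.mem_range.1 hj)).trans_eq' ?_
  refine integral_congr_Ioo (segment_lt hn j).le fun x hx => ?_
  rw [floor_mul_eq hn (Ioo_subset_Ico_self hx)]

/-- By duality, the estimate for piecewise constant functions holds for smooth splines of every
degree. -/
theorem norm_prim_sub_proj_le (p n : ℕ) [NeZero n] (v : L2) :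
    ‖prim v - splineProj p ((p : ℤ) - 1) n (prim v)‖ ≤ 1 / (Real.pi * n) * ‖v‖ := by
  induction p generalizing v with
  | zero => exact norm_prim_sub_proj_zero_le n v
  | succ p ih =>
    exact norm_sub_starProjection_apply_le_of_skew _ (spline p ((p : ℤ) - 1) n) prim prim_add
      (fun v hv => prim_mem_spline hv) (constL2_mem_spline p _ n 1) inner_prim_add_inner_prim
      (by positivity) ih v

/-! ### Weak derivatives -/

/-- Test functions on `(0,1)`: smooth, with compact support in `(0,1)`. -/
structure IsTestFun (φ : ℝ → ℝ) : Prop where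
  contDiff : ContDiff ℝ ∞ φ
  hasCompactSupport : HasCompactSupport φ
  tsupport_subset : tsupport φ ⊆ Ioo (0 : ℝ) 1

namespace IsTestFun

variable {φ : ℝ → ℝ}

theorem deriv (hφ : IsTestFun φ) : IsTestFun (deriv φ) :=
  ⟨(contDiff_infty_iff_deriv.1 hφ.contDiff).2, hφ.hasCompactSupport.deriv,
    tsupport_deriv_subset.trans hφ.tsupport_subset⟩

theorem iteratedDeriv (hφ : IsTestFun φ) (i : ℕ) : IsTestFun (iteratedDeriv i φ) := by
  induction i with
  | zero => simpa using hφ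
  | succ i ih => rw [iteratedDeriv_succ]; exact ih.deriv

theorem eq_zero (hφ : IsTestFun φ) {x : ℝ} (hx : x ∉ Ioo (0 : ℝ) 1) : φ x = 0 :=
  image_eq_zero_of_notMem_tsupport fun h => hx (hφ.tsupport_subset h)

theorem integral_deriv (hφ : IsTestFun φ) (x : ℝ) : ∫ t in (0 : ℝ)..x, _root_.deriv φ t = φ x := by
  rw [intervalIntegral.integral_deriv_eq_sub
    (fun t _ => hφ.contDiff.differentiable (by simp) t)
    (hφ.deriv.contDiff.continuous.intervalIntegrable _ _), hφ.eq_zero (x := 0) (by simp), sub_zero]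

theorem intervalIntegrable_mul (hφ : IsTestFun φ) (v : L2) :
    IntervalIntegrable (fun x => v x * φ x) volume 0 1 :=
  (intervalIntegrable_coe v).mul_continuousOn hφ.contDiff.continuous.continuousOn

end IsTestFun

theorem hasWeakDeriv_iff {r : ℕ} {u v : L2} : HasWeakDeriv r u v ↔ ∀ φ, IsTestFun φ →
    ∫ x in (0 : ℝ)..1, u x * iteratedDeriv r φ x =
      (-1 : ℝ) ^ r * ∫ x in (0 : ℝ)..1, v x * φ x := by
  simp only [HasWeakDeriv, setIntegral_Ioo_eq_intervalIntegral]
  exact ⟨fun h φ hφ => h φ hφ.1 hφ.2 hφ.3, fun h φ h1 h2 h3 => h φ ⟨h1, h2, h3⟩⟩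

theorem hasWeakDeriv_one_iff {u v : L2} : HasWeakDeriv 1 u v ↔ ∀ φ, IsTestFun φ →
    ∫ x in (0 : ℝ)..1, u x * deriv φ x = -∫ x in (0 : ℝ)..1, v x * φ x := by
  simp [hasWeakDeriv_iff, iteratedDeriv_one]

/-- Weak derivatives of `u` of order `i + 1` are those of order `i` of the first one. -/
theorem HasWeakDeriv.succ_iff {i : ℕ} {u v w : L2} (h : HasWeakDeriv 1 u v) :
    HasWeakDeriv (i + 1) u w ↔ HasWeakDeriv i v w := by
  rw [hasWeakDeriv_iff, hasWeakDeriv_iff]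
  refine forall₂_congr fun φ hφ => ?_
  rw [iteratedDeriv_succ, hasWeakDeriv_one_iff.1 h _ (hφ.iteratedDeriv i), pow_succ]
  constructor <;> intro h <;> linarith

theorem hasWeakDeriv_zero (u : L2) : HasWeakDeriv 0 u u := by
  simp [HasWeakDeriv]

theorem hasWeakDeriv_prim (v : L2) : HasWeakDeriv 1 (prim v) v := by
  rw [hasWeakDeriv_one_iff]
  intro φ hφ
  have h := integral_primitive_mul (intervalIntegrable_coe v)
    (hφ.deriv.contDiff.continuous.intervalIntegrable 0 1)
  simp only [hφ.integral_deriv, hφ.eq_zero (x := 1) (by simp), mul_zero, zero_sub] at h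
  rw [← h]
  refine intervalIntegral_congr_ae_unit ?_
  filter_upwards [coeFn_prim v] with x hx
  rw [hx]

/-- A smooth function with compact support in `(0,1)` and integral zero is the derivative of
another one. -/
theorem exists_isTestFun_deriv_eq {φ : ℝ → ℝ} (hφ : IsTestFun φ)
    (h0 : ∫ x in (0 : ℝ)..1, φ x = 0) : ∃ ψ, IsTestFun ψ ∧ deriv ψ = φ := by
  have hc := hφ.contDiff.continuous
  -- The point `1 / 2` makes the compact set nonempty when `φ = 0`.
  have hK : IsCompact (tsupport φ ∪ {1 / 2}) := 
    hφ.hasCompactSupport.isCompact.union isCompact_singleton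
  have hK0 : (tsupport φ ∪ {1 / 2}).Nonempty := ⟨1 / 2, by simp⟩
  have hK1 : tsupport φ ∪ {1 / 2} ⊆ Ioo (0 : ℝ) 1 :=
    union_subset hφ.tsupport_subset (by norm_num)
  obtain ⟨α, hα, hαl⟩ := hK.exists_isLeast hK0
  obtain ⟨β, hβ, hβg⟩ := hK.exists_isGreatest hK0
  have hz : ∀ x, x ∉ Icc α β → φ x = 0 := fun x hx =>
    image_eq_zero_of_notMem_tsupport fun h => hx ⟨hαl (Or.inl h), hβg (Or.inl h)⟩
  set ψ : ℝ → ℝ := fun x => ∫ t in (0 : ℝ)..x, φ t with hψ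
  have hd : ∀ x, HasDerivAt ψ (φ x) x := fun x => hc.integral_hasStrictDerivAt 0 x |>.hasDerivAt
  have hdψ : deriv ψ = φ := funext fun x => (hd x).deriv
  have hsub : tsupport ψ ⊆ Icc α β := by
    refine closure_minimal (fun x hx => ?_) isClosed_Icc
    by_contra hxI
    apply hx
    rcases not_and_or.1 hxI with h | h
    · -- left of the support
      rw [not_le] at h
      refine (intervalIntegral.integral_congr (g := fun _ => 0) fun t ht => ?_).trans (by simp)
      refine hz t fun htI => ?_
      have h1 : max 0 x < α := max_lt (hK1 hα).1 h
      exact absurd (htI.1.trans ht.2) (not_le.2 h1)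
    · -- right of the support
      rw [not_le] at h
      have h1 : ∫ t in (1 : ℝ)..x, φ t = 0 := by
        refine (intervalIntegral.integral_congr (g := fun _ => 0) fun t ht => ?_).trans (by simp)
        refine hz t fun htI => ?_
        have h1 : β < min 1 x := lt_min (hK1 hβ).2 h
        exact absurd (ht.1.trans htI.2) (not_le.2 h1)
      rw [hψ]
      beta_reduce
      rw [← intervalIntegral.integral_add_adjacent_intervals (hc.intervalIntegrable 0 1)
        (hc.intervalIntegrable 1 x), h0, h1, add_zero]
  refine ⟨ψ, ⟨?_, ?_, ?_⟩, hdψ⟩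
  · exact contDiff_infty_iff_deriv.2 ⟨fun x => (hd x).differentiableAt, hdψ ▸ hφ.contDiff⟩
  · exact isCompact_Icc.of_isClosed_subset (isClosed_tsupport ψ) hsub
  · exact hsub.trans fun x hx => ⟨(hK1 hα).1.trans_le hx.1, hx.2.trans_lt (hK1 hβ).2⟩

theorem exists_isTestFun_integral_eq_one :
    ∃ η, IsTestFun η ∧ ∫ x in (0 : ℝ)..1, η x = 1 := by
  let b : ContDiffBump (1 / 2 : ℝ) := ⟨1 / 8, 1 / 4, by norm_num, by norm_num⟩
  have ht : IsTestFun (b.normed volume) := by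
    refine ⟨b.contDiff_normed, b.hasCompactSupport_normed, ?_⟩
    rw [b.tsupport_normed_eq, Real.closedBall_eq_Icc]
    intro x hx
    have h1 : (1 / 2 : ℝ) - 1 / 4 ≤ x := hx.1
    have h2 : x ≤ (1 / 2 : ℝ) + 1 / 4 := hx.2
    constructor <;> linarith
  refine ⟨_, ht, ?_⟩
  rw [← setIntegral_Ioo_eq_intervalIntegral,
    setIntegral_eq_integral_of_forall_compl_eq_zero fun x hx => ht.eq_zero hx]
  exact b.integral_normed

/-- The lemma of du Bois-Reymond. -/
theorem eq_constL2_of_integral_mul_deriv_eq_zero {h : L2}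
    (h0 : ∀ φ, IsTestFun φ → ∫ x in (0 : ℝ)..1, h x * deriv φ x = 0) : ∃ c, h = constL2 c := by
  obtain ⟨η, hη, hη1⟩ := exists_isTestFun_integral_eq_one
  set c : ℝ := ∫ x in (0 : ℝ)..1, h x * η x with hc
  refine ⟨c, ?_⟩
  have key : ∀ g, IsTestFun g → ∫ x in (0 : ℝ)..1, g x * (h x - c) = 0 := by
    intro g hg
    set m : ℝ := ∫ x in (0 : ℝ)..1, g x with hm
    have hgc := hg.contDiff.continuous
    have hηc := hη.contDiff.continuous
    -- subtracting a multiple of `η` leaves a test function of integral zero, hence a derivative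
    have hφ : IsTestFun (fun x => g x - m * η x) := by
      refine ⟨hg.contDiff.sub (contDiff_const.mul hη.contDiff), ?_, ?_⟩
      · exact hg.hasCompactSupport.sub hη.hasCompactSupport.mul_left
      · refine (tsupport_sub _ _).trans (union_subset hg.tsupport_subset ?_)
        exact (tsupport_mul_subset_right).trans hη.tsupport_subset
    obtain ⟨ψ, hψ, hψd⟩ := exists_isTestFun_deriv_eq hφ (by
      rw [intervalIntegral.integral_sub (hgc.intervalIntegrable _ _)
        ((hηc.intervalIntegrable _ _).const_mul _), intervalIntegral.integral_const_mul, hη1]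
      linarith)
    have h1 := h0 ψ hψ
    rw [hψd] at h1
    have e1 : ∫ x in (0 : ℝ)..1, h x * (g x - m * η x) =
        (∫ x in (0 : ℝ)..1, h x * g x) - m * c := by
      rw [hc, ← intervalIntegral.integral_const_mul, ← intervalIntegral.integral_sub
        (hg.intervalIntegrable_mul h) ((hη.intervalIntegrable_mul h).const_mul m)]
      congr 1
      ext x
      ring
    have e2 : ∫ x in (0 : ℝ)..1, g x * (h x - c) =
        (∫ x in (0 : ℝ)..1, h x * g x) - c * m := by
      rw [hm, ← intervalIntegral.integral_const_mul, ← intervalIntegral.integral_sub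
        (hg.intervalIntegrable_mul h) ((hgc.intervalIntegrable _ _).const_mul c)]
      congr 1
      ext x
      ring
    rw [e2]
    linarith
  have hint : IntegrableOn (fun x => h x - c) (Ioo 0 1) volume := by
    have := intervalIntegrable_iff_integrable_unitMeasure.1
      ((intervalIntegrable_coe h).sub (intervalIntegrable_const (c := c)))
    exact this
  have hae := isOpen_Ioo.ae_eq_zero_of_integral_contDiff_smul_eq_zero (U := Ioo (0 : ℝ) 1)
    (f := fun x => h x - c) hint.locallyIntegrableOn (by
      intro g h1 h2 h3
      have hg : IsTestFun g := ⟨h1, h2, h3⟩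
      have := key g hg
      rw [← setIntegral_Ioo_eq_intervalIntegral,
        setIntegral_eq_integral_of_forall_compl_eq_zero
          fun x hx => by rw [hg.eq_zero hx, zero_mul]] at this
      simpa using this)
  apply Lp.ext
  filter_upwards [coeFn_constL2 c, (ae_restrict_iff' measurableSet_Ioo).2 hae] with x h1 h2
  rw [h1]
  linarith

theorem HasWeakDeriv.exists_eq_const_add_prim {u v : L2} (h : HasWeakDeriv 1 u v) :
    ∃ c, u = constL2 c + prim v := by
  obtain ⟨c, hc⟩ := eq_constL2_of_integral_mul_deriv_eq_zero (h := u - prim v) (by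
    intro φ hφ
    have h1 := hasWeakDeriv_one_iff.1 h φ hφ
    rw [← hasWeakDeriv_one_iff.1 (hasWeakDeriv_prim v) φ hφ, ← sub_eq_zero,
      ← intervalIntegral.integral_sub (hφ.deriv.intervalIntegrable_mul u)
        (hφ.deriv.intervalIntegrable_mul (prim v))] at h1
    refine Eq.trans (intervalIntegral_congr_ae_unit ?_) h1
    filter_upwards [Lp.coeFn_sub u (prim v)] with x hx
    rw [hx, Pi.sub_apply, sub_mul])
  exact ⟨c, by rw [← hc, sub_add_cancel]⟩

/-- The error estimate for splines of maximal smoothness with the constant `(h / π)^(p + 1)`,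
where `h = 1 / n`. -/
theorem norm_sub_splineProj_le (p n : ℕ) [NeZero n] {f g : L2} (hf : f ∈ sobolev (p + 1))
    (hg : HasWeakDeriv (p + 1) f g) :
    ‖f - splineProj p ((p : ℤ) - 1) n f‖ ≤ (1 / (Real.pi * n)) ^ (p + 1) * ‖g‖ := by
  induction p generalizing f g with
  | zero =>
    obtain ⟨c, rfl⟩ := HasWeakDeriv.exists_eq_const_add_prim hg
    rw [splineProj, sub_starProjection_add _ _ (constL2_mem_spline _ _ n c), zero_add, pow_one]
    exact norm_prim_sub_proj_le 0 n g
  | succ p ih =>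
    obtain ⟨v, hv⟩ := hf 1 (by omega)
    have hvs : v ∈ sobolev (p + 1) := fun i hi => by
      obtain ⟨w, hw⟩ := hf (i + 1) (by omega)
      exact ⟨w, hv.succ_iff.1 hw⟩
    have h1 := ih hvs (hv.succ_iff.1 hg)
    obtain ⟨c, rfl⟩ := hv.exists_eq_const_add_prim
    rw [splineProj, sub_starProjection_add _ _ (constL2_mem_spline _ _ n c)]
    set s := splineProj p ((p : ℤ) - 1) n v with hs
    have hsm : s ∈ spline p ((p : ℤ) - 1) n := Submodule.starProjection_apply_mem _ _
    have hvv : prim v = prim s + prim (v - s) := by rw [← prim_add, add_sub_cancel]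
    rw [hvv, sub_starProjection_add _ _ (prim_mem_spline hsm), pow_succ' _ (p + 1), mul_assoc]
    exact (norm_prim_sub_proj_le (p + 1) n (v - s)).trans
      (mul_le_mul_of_nonneg_left h1 (by positivity))

/-! ### Monic polynomials of least norm -/

open Polynomial in
theorem integral_derivative_mul_eval (A M : ℝ[X]) {a b : ℝ} (ha : A.eval a = 0)
    (hb : A.eval b = 0) :
    ∫ x in a..b, (derivative A).eval x * M.eval x =
      -∫ x in a..b, A.eval x * (derivative M).eval x := by
  have h := intervalIntegral.integral_deriv_mul_eq_sub (a := a) (b := b)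
    (fun x _ => A.hasDerivAt x) (fun x _ => M.hasDerivAt x)
    ((derivative A).continuous.intervalIntegrable _ _)
    ((derivative M).continuous.intervalIntegrable _ _)
  rw [intervalIntegral.integral_add (Continuous.intervalIntegrable (by fun_prop) _ _)
    (Continuous.intervalIntegrable (by fun_prop) _ _), ha, hb] at h
  linarith

open Polynomial in
/-- Repeated integration by parts against `((X - a) (X - b))^q`, whose derivatives of order below
`q` vanish at both ends. -/
theorem integral_iterate_derivative_mul_eval (a b : ℝ) (q k : ℕ) (hk : k ≤ q) (M : ℝ[X]) :
    ∫ x in a..b, (derivative^[k] (((X - C a) * (X - C b)) ^ q)).eval x * M.eval x =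
      (-1) ^ k * ∫ x in a..b, (((X - C a) * (X - C b)) ^ q).eval x *
        (derivative^[k] M).eval x := by
  induction k generalizing M with
  | zero => simp
  | succ k ih =>
    have hz : ∀ c : ℝ, (X - C c) ∣ (X - C a) * (X - C b) →
        (derivative^[k] (((X - C a) * (X - C b)) ^ q)).eval c = 0 := by
      intro c hc
      have h1 := pow_sub_dvd_iterate_derivative_of_pow_dvd k (pow_dvd_pow_of_dvd hc q)
      rw [← IsRoot, ← dvd_iff_isRoot]
      exact (dvd_pow_self _ (by omega)).trans h1
    rw [Function.iterate_succ_apply', integral_derivative_mul_eval _ _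
      (hz a (dvd_mul_right _ _)) (hz b (dvd_mul_left _ _)), ih (by omega),
      ← Function.iterate_succ_apply,
      pow_succ]
    ring

/-- Euler's Beta integral with integer exponents. -/
theorem integral_sub_pow_mul_sub_pow (a b : ℝ) (m k : ℕ) :
    ∫ x in a..b, (x - a) ^ m * (b - x) ^ k =
      (m.factorial * k.factorial / (m + k + 1).factorial : ℝ) * (b - a) ^ (m + k + 1) := by
  induction k generalizing m with
  | zero =>
    have h := intervalIntegral.integral_comp_sub_right (a := a) (b := b) (fun x : ℝ => x ^ m) a
    simp only [pow_zero, mul_one, Nat.factorial_zero, Nat.cast_one, add_zero]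
    rw [h, integral_pow, Nat.factorial_succ]
    have : (m.factorial : ℝ) ≠ 0 := by positivity
    push_cast
    field_simp
    simp
  | succ k ih =>
    have hp : ∀ x ∈ uIcc a b, HasDerivAt (fun x : ℝ => (x - a) ^ (m + 1) / (m + 1))
        ((x - a) ^ m) x := by
      intro x _
      have := (((hasDerivAt_id x).sub_const a).pow (m + 1)).div_const ((m : ℝ) + 1)
      convert! this using 1
      have : (m : ℝ) + 1 ≠ 0 := by positivity
      push_cast
      field_simp
      simp
    have hq : ∀ x ∈ uIcc a b, HasDerivAt (fun x : ℝ => (b - x) ^ (k + 1))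
        (-((k + 1) * (b - x) ^ k)) x := by
      intro x _
      have := ((hasDerivAt_id x).const_sub b).pow (k + 1)
      convert! this using 1
      simp
    have h := intervalIntegral.integral_deriv_mul_eq_sub hp hq
      (Continuous.intervalIntegrable (by fun_prop) _ _)
      (Continuous.intervalIntegrable (by fun_prop) _ _)
    rw [intervalIntegral.integral_add (Continuous.intervalIntegrable (by fun_prop) _ _)
      (Continuous.intervalIntegrable (by fun_prop) _ _)] at h
    have e : ∫ x in a..b, (x - a) ^ (m + 1) / ((m : ℝ) + 1) * -(((k : ℝ) + 1) * (b - x) ^ k) =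
        -((k + 1) / (m + 1)) * ∫ x in a..b, (x - a) ^ (m + 1) * (b - x) ^ k := by
      rw [← intervalIntegral.integral_const_mul]
      congr 1
      ext x
      ring
    rw [e, ih (m + 1)] at h
    simp only [sub_self, ne_eq, Nat.add_eq_zero_iff, one_ne_zero, and_false, not_false_eq_true,
      zero_pow, mul_zero, zero_div, zero_mul] at h
    rw [show m + (k + 1) + 1 = m + 1 + k + 1 by ring]
    have h0 : (m : ℝ) + 1 ≠ 0 := by positivity
    rw [Nat.factorial_succ m] at h
    rw [Nat.factorial_succ k]
    push_cast at h ⊢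
    field_simp at h ⊢
    linarith

open Polynomial in
/-- Among monic polynomials of degree `q`, the scaled Legendre polynomial has the smallest
`L²`-norm. -/
theorem le_integral_eval_sq_of_monic {M : ℝ[X]} {q : ℕ} (hM : M.Monic) (hq : M.natDegree = q)
    {a b : ℝ} (hab : a ≤ b) :
    ((q.factorial : ℝ) ^ 4 / ((2 * q).factorial * (2 * q + 1).factorial)) * (b - a) ^ (2 * q + 1) ≤
      ∫ x in a..b, M.eval x ^ 2 := by
  set w : ℝ[X] := ((X - C a) * (X - C b)) ^ q with hw
  set L := derivative^[q] w with hL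
  -- the `n`-th derivative of a monic polynomial of degree `n` is `n!`
  have hder : ∀ (n : ℕ) (A : ℝ[X]), A.Monic → A.natDegree = n →
      derivative^[n] A = C (n.factorial : ℝ) := by
    intro n A hA hn
    ext i
    rw [coeff_iterate_derivative, coeff_C]
    rcases Nat.eq_zero_or_pos i with rfl | hi
    · have : A.coeff n = 1 := by rw [← hn]; exact hA
      simp [this, Nat.descFactorial_self]
    · rw [coeff_eq_zero_of_natDegree_lt (by omega), if_neg (by omega)]
      simp
  have hwm : w.Monic := ((monic_X_sub_C a).mul (monic_X_sub_C b)).pow q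
  have hwd : w.natDegree = 2 * q := by
    rw [hw, ((monic_X_sub_C a).mul (monic_X_sub_C b)).natDegree_pow,
      (monic_X_sub_C a).natDegree_mul (monic_X_sub_C b)]
    simp; ring
  have hLq : derivative^[q] L = C ((2 * q).factorial : ℝ) := by
    rw [hL, ← Function.iterate_add_apply, ← two_mul, hder _ w hwm hwd]
  set β : ℝ := ∫ x in a..b, (x - a) ^ q * (b - x) ^ q with hβ
  have hwβ : ∀ r : ℝ, (-1) ^ q * ∫ x in a..b, w.eval x * (C r).eval x = r * β := by
    intro r
    rw [hβ, ← intervalIntegral.integral_const_mul, ← intervalIntegral.integral_const_mul]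
    congr 1
    ext x
    simp only [hw, eval_pow, eval_mul, eval_sub, eval_X, eval_C]
    rw [show b - x = (-1) * (x - b) by ring, mul_pow, mul_pow]
    ring
  have hLM : ∫ x in a..b, L.eval x * M.eval x = q.factorial * β := by
    rw [hL, integral_iterate_derivative_mul_eval a b q q le_rfl M, hder q M hM hq, hwβ]
  have hLL : ∫ x in a..b, L.eval x * L.eval x = (2 * q).factorial * β := by
    conv_lhs => rw [hL]
    rw [integral_iterate_derivative_mul_eval a b q q le_rfl, ← hw, ← hL, hLq, hwβ]
  -- `t * L` is monic of degree `q` and orthogonal to all polynomials of smaller degree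
  set t : ℝ := q.factorial / (2 * q).factorial with ht
  have h0 : 0 ≤ ∫ x in a..b, (M.eval x - t * L.eval x) ^ 2 :=
    intervalIntegral.integral_nonneg hab fun x _ => sq_nonneg _
  have e : ∫ x in a..b, (M.eval x - t * L.eval x) ^ 2 = (∫ x in a..b, M.eval x ^ 2) -
      2 * t * (∫ x in a..b, L.eval x * M.eval x) + t ^ 2 * ∫ x in a..b, L.eval x * L.eval x := by
    have i1 : IntervalIntegrable (fun x => M.eval x ^ 2) volume a b :=
      Continuous.intervalIntegrable (by fun_prop) _ _
    have i2 : IntervalIntegrable (fun x => L.eval x * M.eval x) volume a b :=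
      Continuous.intervalIntegrable (by fun_prop) _ _
    have i3 : IntervalIntegrable (fun x => L.eval x * L.eval x) volume a b :=
      Continuous.intervalIntegrable (by fun_prop) _ _
    rw [← intervalIntegral.integral_const_mul, ← intervalIntegral.integral_const_mul,
      ← intervalIntegral.integral_sub i1 (i2.const_mul _),
      ← intervalIntegral.integral_add (i1.sub (i2.const_mul _)) (i3.const_mul _)]
    congr 1
    ext x
    ring
  have hβv := integral_sub_pow_mul_sub_pow a b q q
  rw [← hβ, ← two_mul] at hβv
  have hfin : 2 * t * (q.factorial * β) - t ^ 2 * ((2 * q).factorial * β) =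
      ((q.factorial : ℝ) ^ 4 / ((2 * q).factorial * (2 * q + 1).factorial)) *
        (b - a) ^ (2 * q + 1) := by
    rw [hβv, ht]
    field_simp
    ring
  rw [e, hLM, hLL] at h0
  linarith

/-! ### Comparison of the two bounds -/

/-- The comparison for two segments. The inequality fails for `q = 18`. -/
theorem factorial_ineq_two {q : ℕ} (hq : 19 ≤ q) :
    ((2 * q).factorial * (2 * q + 1).factorial : ℝ) * 2 ^ (2 * q) <
      (q.factorial : ℝ) ^ 2 * (Real.pi * (q + 1)) ^ (2 * q) := by
  induction q, hq using Nat.le_induction with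
  | base =>
    have h : ((3.1415 : ℝ) * 20) ^ 38 ≤ (Real.pi * ((19 : ℕ) + 1)) ^ 38 := by
      have := Real.pi_gt_d4
      gcongr
      norm_num
    refine lt_of_lt_of_le ?_ (mul_le_mul_of_nonneg_left h (by positivity))
    norm_num [Nat.factorial]
  | succ q hq ih =>
    have hN : (20 : ℝ) ≤ (q : ℝ) + 1 := by
      have : (19 : ℝ) ≤ q := by exact_mod_cast hq
      linarith
    set N : ℝ := (q : ℝ) + 1 with hNdef
    have hN0 : 0 < N := by linarith
    -- From `q` to `q + 1` the left side is multiplied by less than `64 N⁴`, and the right side by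
    -- `π² (1 + 1 / N)^(2 N) N⁴`. The power tends to `e²`, and `6.5 π² > 64` while `6.5 < e²`.
    have hexp : (6.5 : ℝ) ≤ (1 + 1 / N) ^ (2 * (q + 1)) := by
      have hlog := Real.le_log_one_add_of_nonneg (x := 1 / N) (by positivity)
      have h1 : (1.9 : ℝ) ≤ ((2 * (q + 1) : ℕ) : ℝ) * Real.log (1 + 1 / N) := by
        have h2 : (0.95 : ℝ) ≤ N * (2 * (1 / N) / (1 / N + 2)) := by
          have : N * (2 * (1 / N) / (1 / N + 2)) = 2 * N / (1 + 2 * N) := by field_simp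
          rw [this, le_div_iff₀ (by positivity)]
          linarith
        have h3 := mul_le_mul_of_nonneg_left hlog hN0.le
        have h4 : ((2 * (q + 1) : ℕ) : ℝ) = 2 * N := by push_cast; ring
        rw [h4]
        linarith
      have h5 : (1 + 1 / N) ^ (2 * (q + 1)) =
          Real.exp (((2 * (q + 1) : ℕ) : ℝ) * Real.log (1 + 1 / N)) := by
        rw [Real.exp_nat_mul, Real.exp_log (by positivity)]
      rw [h5]
      refine le_trans ?_ (Real.exp_le_exp.2 h1)
      have h6 : Real.exp 1.9 = Real.exp 1 * Real.exp 0.45 * Real.exp 0.45 := by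
        rw [← Real.exp_add, ← Real.exp_add]; norm_num
      have h7 := Real.exp_one_gt_d9
      have h8 := Real.quadratic_le_exp_of_nonneg (x := 0.45) (by norm_num)
      have h8' : (1.55125 : ℝ) ≤ Real.exp 0.45 := by norm_num at h8 ⊢; linarith
      rw [h6]
      calc (6.5 : ℝ) ≤ 2.7182818283 * 1.55125 * 1.55125 := by norm_num
        _ ≤ _ := by gcongr
    have hpow : (6.5 : ℝ) * (Real.pi * N) ^ (2 * (q + 1)) ≤
        (Real.pi * (N + 1)) ^ (2 * (q + 1)) := by
      have : Real.pi * (N + 1) = (1 + 1 / N) * (Real.pi * N) := by field_simp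
      rw [this, mul_pow (1 + 1 / N)]
      gcongr
    have hpi : (64 : ℝ) ≤ 6.5 * Real.pi ^ 2 := by
      have h1 := Real.pi_gt_d4
      have h2 : (3.1415 : ℝ) ^ 2 ≤ Real.pi ^ 2 := by gcongr
      linarith
    have e1 : ((2 * (q + 1)).factorial * (2 * (q + 1) + 1).factorial : ℝ) * 2 ^ (2 * (q + 1)) =
        ((2 * q).factorial * (2 * q + 1).factorial * 2 ^ (2 * q)) *
          (16 * N ^ 2 * (4 * N ^ 2 - 1)) := by
      rw [show 2 * (q + 1) + 1 = 2 * q + 1 + 1 + 1 by ring, show 2 * (q + 1) = 2 * q + 1 + 1 by ring,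
        Nat.factorial_succ (2 * q + 1 + 1), Nat.factorial_succ (2 * q + 1),
        Nat.factorial_succ (2 * q), hNdef]
      push_cast
      ring
    have e2 : ((q + 1).factorial : ℝ) ^ 2 * (6.5 * (Real.pi * N) ^ (2 * (q + 1))) =
        ((q.factorial : ℝ) ^ 2 * (Real.pi * N) ^ (2 * q)) * (6.5 * Real.pi ^ 2 * N ^ 4) := by
      rw [Nat.factorial_succ, Nat.cast_mul, Nat.cast_succ, ← hNdef]
      ring
    have hfac : 16 * N ^ 2 * (4 * N ^ 2 - 1) ≤ 6.5 * Real.pi ^ 2 * N ^ 4 := by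
      have := mul_le_mul_of_nonneg_right hpi (pow_nonneg hN0.le 4)
      nlinarith [sq_nonneg N]
    calc ((2 * (q + 1)).factorial * (2 * (q + 1) + 1).factorial : ℝ) * 2 ^ (2 * (q + 1))
        = ((2 * q).factorial * (2 * q + 1).factorial * 2 ^ (2 * q)) *
          (16 * N ^ 2 * (4 * N ^ 2 - 1)) := e1
      _ < ((q.factorial : ℝ) ^ 2 * (Real.pi * N) ^ (2 * q)) * (16 * N ^ 2 * (4 * N ^ 2 - 1)) :=
        mul_lt_mul_of_pos_right ih (mul_pos (by positivity) (by nlinarith))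
      _ ≤ ((q.factorial : ℝ) ^ 2 * (Real.pi * N) ^ (2 * q)) * (6.5 * Real.pi ^ 2 * N ^ 4) := by
        gcongr
      _ = ((q + 1).factorial : ℝ) ^ 2 * (6.5 * (Real.pi * N) ^ (2 * (q + 1))) := e2.symm
      _ ≤ ((q + 1).factorial : ℝ) ^ 2 * (Real.pi * (N + 1)) ^ (2 * (q + 1)) := by gcongr
      _ = _ := by rw [hNdef]; push_cast; rfl

/-- The comparison for three segments, up to the degree from which two segments suffice. -/
theorem factorial_ineq_three {q : ℕ} (hq : 2 ≤ q) (hq' : q ≤ 18) :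
    ((2 * q).factorial * (2 * q + 1).factorial : ℝ) * 3 ^ (2 * q) <
      (q.factorial : ℝ) ^ 2 * (Real.pi * (2 * q + 1)) ^ (2 * q) := by
  have h : ((3.14 : ℝ) * (2 * q + 1)) ^ (2 * q) ≤ (Real.pi * (2 * q + 1)) ^ (2 * q) := by
    have := Real.pi_gt_d2
    gcongr
  refine lt_of_lt_of_le ?_ (mul_le_mul_of_nonneg_left h (by positivity))
  clear h
  interval_cases q <;> norm_num [Nat.factorial]

theorem factorial_ineq {p n : ℕ} (hpn : (3 ≤ n ∧ 1 ≤ p ∧ p ≤ 17) ∨ (2 ≤ n ∧ 18 ≤ p)) :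
    ((2 * (p + 1)).factorial * (2 * (p + 1) + 1).factorial : ℝ) * (n : ℝ) ^ (2 * (p + 1)) <
      ((p + 1).factorial : ℝ) ^ 2 *
        (Real.pi * (((n - 1) * (p + 1) + 1 : ℕ) : ℝ)) ^ (2 * (p + 1)) := by
  -- `((n - 1) q + 1) / n` increases with `n`, so the smallest `n` decides
  have mono : ∀ n₀ : ℕ, 1 ≤ n₀ → n₀ ≤ n →
      ((2 * (p + 1)).factorial * (2 * (p + 1) + 1).factorial : ℝ) * (n₀ : ℝ) ^ (2 * (p + 1)) <
        ((p + 1).factorial : ℝ) ^ 2 *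
          (Real.pi * (((n₀ - 1) * (p + 1) + 1 : ℕ) : ℝ)) ^ (2 * (p + 1)) →
      ((2 * (p + 1)).factorial * (2 * (p + 1) + 1).factorial : ℝ) * (n : ℝ) ^ (2 * (p + 1)) <
        ((p + 1).factorial : ℝ) ^ 2 *
          (Real.pi * (((n - 1) * (p + 1) + 1 : ℕ) : ℝ)) ^ (2 * (p + 1)) := by
    intro n₀ h1 h2 h
    have hn0 : (0 : ℝ) < n₀ := by exact_mod_cast h1
    have hn : (0 : ℝ) < n := by exact_mod_cast h1.trans h2
    have h12 : (n₀ : ℝ) ≤ n := by exact_mod_cast h2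
    have hcomp : Real.pi * (((n₀ - 1) * (p + 1) + 1 : ℕ) : ℝ) * n ≤
        Real.pi * (((n - 1) * (p + 1) + 1 : ℕ) : ℝ) * n₀ := by
      rw [mul_assoc, mul_assoc]
      refine mul_le_mul_of_nonneg_left ?_ Real.pi_pos.le
      push_cast [Nat.cast_sub h1, Nat.cast_sub (h1.trans h2)]
      nlinarith [mul_nonneg (sub_nonneg.2 h12) (Nat.cast_nonneg (α := ℝ) p)]
    have hpow := pow_le_pow_left₀ (by positivity) hcomp (2 * (p + 1))
    rw [mul_pow _ (n : ℝ), mul_pow _ (n₀ : ℝ)] at hpow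
    refine lt_of_mul_lt_mul_right ?_ (pow_pos hn0 (2 * (p + 1))).le
    have h3 := mul_lt_mul_of_pos_right h (pow_pos hn (2 * (p + 1)))
    have h4 := mul_le_mul_of_nonneg_left hpow (sq_nonneg ((p + 1).factorial : ℝ))
    linarith
  rcases hpn with ⟨hn, hp, hp'⟩ | ⟨hn, hp⟩
  · refine mono 3 (by norm_num) hn ?_
    have := factorial_ineq_three (q := p + 1) (by omega) (by omega)
    push_cast at this ⊢
    convert this using 4
  · refine mono 2 (by norm_num) hn ?_
    have := factorial_ineq_two (q := p + 1) (by omega)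
    push_cast at this ⊢
    convert this using 4
    norm_num

/-! ### Polynomials as functions on the unit interval -/

/-- A polynomial, as an element of `L²(0,1)`. -/
noncomputable def polyL2 (P : Polynomial ℝ) : L2 :=
  (memLp_of_continuousOn P.continuous.continuousOn).toLp (fun x => P.eval x)

theorem coeFn_polyL2 (P : Polynomial ℝ) : polyL2 P =ᵐ[unitMeasure] fun x => P.eval x :=
  MemLp.coeFn_toLp _

theorem hasWeakDeriv_polyL2 (P : Polynomial ℝ) (i : ℕ) :
    HasWeakDeriv i (polyL2 P) (polyL2 (Polynomial.derivative^[i] P)) := by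
  have one : ∀ P : Polynomial ℝ, HasWeakDeriv 1 (polyL2 P) (polyL2 (Polynomial.derivative P)) := by
    intro P
    rw [hasWeakDeriv_one_iff]
    intro φ hφ
    have h := intervalIntegral.integral_mul_deriv_eq_deriv_mul (a := 0) (b := 1)
      (fun x _ => P.hasDerivAt x)
      (fun x _ => (hφ.contDiff.differentiable (by simp) x).hasDerivAt)
      (P.derivative.continuous.intervalIntegrable _ _)
      (hφ.deriv.contDiff.continuous.intervalIntegrable _ _)
    rw [hφ.eq_zero (x := 0) (by simp), hφ.eq_zero (x := 1) (by simp), mul_zero, mul_zero, sub_zero,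
      zero_sub] at h
    refine Eq.trans (intervalIntegral_congr_ae_unit ?_)
      (h.trans (congrArg Neg.neg (intervalIntegral_congr_ae_unit ?_)))
    · filter_upwards [coeFn_polyL2 P] with x hx
      rw [hx]
    · filter_upwards [coeFn_polyL2 P.derivative] with x hx
      rw [hx]
  induction i generalizing P with
  | zero => exact hasWeakDeriv_zero _
  | succ i ih => exact (one P).succ_iff.2 (ih _)

theorem polyL2_mem_sobolev (P : Polynomial ℝ) (r : ℕ) : polyL2 P ∈ sobolev r :=
  fun i _ => ⟨_, hasWeakDeriv_polyL2 P i⟩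

theorem norm_polyL2_C (r : ℝ) : ‖polyL2 (Polynomial.C r)‖ = |r| := by
  rw [← sq_eq_sq₀ (norm_nonneg _) (abs_nonneg _), norm_sq_eq_integral, sq_abs]
  refine (intervalIntegral_congr_ae_unit (g := fun _ => r ^ 2) ?_).trans (by simp)
  filter_upwards [coeFn_polyL2 (Polynomial.C r)] with x hx
  rw [hx, Polynomial.eval_C]

theorem hasWeakDeriv_X_pow (r : ℕ) :
    HasWeakDeriv r (polyL2 (Polynomial.X ^ r)) (polyL2 (Polynomial.C (r.factorial : ℝ))) := by
  have h := hasWeakDeriv_polyL2 (Polynomial.X ^ r) r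
  rwa [Polynomial.iterate_derivative_X_pow_eq_natCast_mul, Nat.descFactorial_self, Nat.sub_self,
    pow_zero, mul_one, ← Polynomial.C_eq_natCast] at h

/-- On each of the `n` segments, `x ^ (p + 1)` minus a spline is a monic polynomial of degree
`p + 1`. -/
theorem le_norm_X_pow_sub_sq (p : ℕ) (k : ℤ) (n : ℕ) [NeZero n] {s : L2} (hs : s ∈ spline p k n) :
    ((p + 1).factorial : ℝ) ^ 4 / ((2 * (p + 1)).factorial * (2 * (p + 1) + 1).factorial) *
      (1 / n) ^ (2 * (p + 1)) ≤ ‖polyL2 (Polynomial.X ^ (p + 1)) - s‖ ^ 2 := by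
  have hn : 0 < n := Nat.pos_of_ne_zero (NeZero.ne n)
  have hn' : (0 : ℝ) < n := by exact_mod_cast hn
  obtain ⟨f, -, hf, hsf⟩ := hs
  set u := polyL2 (Polynomial.X ^ (p + 1)) - s with hu
  have hae : (fun x => u x ^ 2) =ᵐ[unitMeasure] fun x => (x ^ (p + 1) - f x) ^ 2 := by
    filter_upwards [Lp.coeFn_sub (polyL2 (Polynomial.X ^ (p + 1))) s,
      coeFn_polyL2 (Polynomial.X ^ (p + 1)), hsf] with x h1 h2 h3
    rw [hu, h1, Pi.sub_apply, h2, h3, Polynomial.eval_pow, Polynomial.eval_X]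
  have hint : IntervalIntegrable (fun x => (x ^ (p + 1) - f x) ^ 2) volume 0 1 :=
    intervalIntegrable_iff_integrable_unitMeasure.2
      ((intervalIntegrable_iff_integrable_unitMeasure.1 (intervalIntegrable_coe_sq u)).congr hae)
  rw [norm_sq_eq_integral, intervalIntegral_congr_ae_unit hae,
    integral_unit_eq_sum_segments hn hint]
  set K : ℝ := ((p + 1).factorial : ℝ) ^ 4 /
    ((2 * (p + 1)).factorial * (2 * (p + 1) + 1).factorial) with hK
  have hseg : ∀ j ∈ Finset.range n, K * (1 / n) ^ (2 * (p + 1) + 1) ≤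
      ∫ x in ((j : ℝ) / n)..(((j : ℝ) + 1) / n), (x ^ (p + 1) - f x) ^ 2 := by
    intro j hj
    obtain ⟨P, hP, hfP⟩ := hf j (Finset.mem_range.1 hj)
    have hdeg : P.degree < (p + 1 : ℕ) :=
      (Polynomial.degree_le_of_natDegree_le hP).trans_lt (by exact_mod_cast Nat.lt_succ_self p)
    have hmon : (Polynomial.X ^ (p + 1) - P).Monic :=
      Polynomial.monic_X_pow_sub (by simpa using hdeg)
    have hnat : (Polynomial.X ^ (p + 1) - P).natDegree = p + 1 := by
      rw [Polynomial.natDegree_sub_eq_left_of_natDegree_lt, Polynomial.natDegree_X_pow]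
      rw [Polynomial.natDegree_X_pow]
      omega
    have h := le_integral_eval_sq_of_monic hmon hnat (segment_lt hn j).le
    rw [show ((j : ℝ) + 1) / n - j / n = 1 / n by ring] at h
    refine h.trans_eq (integral_congr_Ioo (segment_lt hn j).le fun x hx => ?_)
    rw [hfP x (Ioo_subset_Ico_self hx), Polynomial.eval_sub, Polynomial.eval_pow, Polynomial.eval_X]
  have hsum := Finset.sum_le_sum hseg
  rw [Finset.sum_const, Finset.card_range, nsmul_eq_mul] at hsum
  refine le_trans (le_of_eq ?_) hsum
  rw [pow_succ (1 / (n : ℝ)) (2 * (p + 1))]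
  field_simp

/-! ### Best constants -/

theorem nonneg_of_mem_errorConstants {p : ℕ} {k : ℤ} {n : ℕ} [NeZero n] {q : ℕ} {C : ℝ}
    (hC : C ∈ errorConstants p k n q) : 0 ≤ C := by
  have h := hC _ (polyL2_mem_sobolev _ _) _ (hasWeakDeriv_X_pow (q + 1))
  rw [norm_polyL2_C] at h
  exact nonneg_of_mul_nonneg_left ((norm_nonneg _).trans h) (abs_pos.2 (by positivity))

theorem bddBelow_errorConstants (p : ℕ) (k : ℤ) (n : ℕ) [NeZero n] (q : ℕ) :
    BddBelow (errorConstants p k n q) :=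
  ⟨0, fun _ hC => nonneg_of_mem_errorConstants hC⟩

theorem isLeast_bestConst {p : ℕ} {k : ℤ} {n : ℕ} [NeZero n]
    (h : (errorConstants p k n p).Nonempty) :
    IsLeast (errorConstants p k n p) (bestConst p k n) := by
  refine ⟨fun f hf g hg => ?_, fun C hC => csInf_le (bddBelow_errorConstants p k n p) hC⟩
  -- If `g = 0`, the inequality does not depend on the constant.
  rcases (norm_nonneg g).eq_or_lt with h0 | h0
  · obtain ⟨C, hC⟩ := h
    simpa [← h0] using hC f hf g hg
  · rw [← div_le_iff₀ h0]
    exact le_csInf h fun C hC => (div_le_iff₀ h0).2 (hC f hf g hg)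

theorem mem_errorConstants_smooth (p n : ℕ) [NeZero n] :
    (1 / (Real.pi * n)) ^ (p + 1) ∈ errorConstants p ((p : ℤ) - 1) n p :=
  fun _ hf _ hg => norm_sub_splineProj_le p n hf hg

/-- Smooth splines are among the discontinuous ones, so their bound shows that admissible constants
exist. -/
theorem mem_errorConstants_discontinuous (p n : ℕ) [NeZero n] :
    (1 / (Real.pi * n)) ^ (p + 1) ∈ errorConstants p (-1) n p := by
  intro f hf g hg
  refine le_trans ?_ (norm_sub_splineProj_le p n hf hg)
  obtain ⟨s, -, hs, hus⟩ : splineProj p ((p : ℤ) - 1) n f ∈ spline p ((p : ℤ) - 1) n :=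
    Submodule.starProjection_apply_mem _ _
  exact norm_sub_starProjection_le _ _ ⟨s, fun r hr => by omega, hs, hus⟩

/-- The test function `x ^ (p + 1)` bounds every admissible constant from below. -/
theorem le_sq_of_mem_errorConstants {p : ℕ} {k : ℤ} {n : ℕ} [NeZero n] {C : ℝ}
    (hC : C ∈ errorConstants p k n p) :
    ((p + 1).factorial : ℝ) ^ 2 / ((2 * (p + 1)).factorial * (2 * (p + 1) + 1).factorial) *
      (1 / n) ^ (2 * (p + 1)) ≤ C ^ 2 := by
  have h := hC _ (polyL2_mem_sobolev _ _) _ (hasWeakDeriv_X_pow (p + 1))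
  rw [norm_polyL2_C, Nat.abs_cast] at h
  have h1 := (le_norm_X_pow_sub_sq p k n (Submodule.starProjection_apply_mem _
    (polyL2 (Polynomial.X ^ (p + 1))))).trans (pow_le_pow_left₀ (norm_nonneg _) h 2)
  have hf : (0 : ℝ) < ((p + 1).factorial : ℝ) ^ 2 := by positivity
  refine le_of_mul_le_mul_right ?_ hf
  rw [← mul_pow C]
  refine le_trans (le_of_eq ?_) h1
  ring

end SplineApprox

theorem mainTheorem4 (p n : ℕ) [NeZero n]
    (hpn : (3 ≤ n ∧ 1 ≤ p ∧ p ≤ 17) ∨ (2 ≤ n ∧ 18 ≤ p)) :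
    IsLeast (SplineApprox.errorConstants p ((p : ℤ) - 1) ((n - 1) * (p + 1) + 1) p)
        (SplineApprox.bestConst p ((p : ℤ) - 1) ((n - 1) * (p + 1) + 1)) ∧
      IsLeast (SplineApprox.errorConstants p (-1) n p) (SplineApprox.bestConst p (-1) n) ∧
      SplineApprox.bestConst p ((p : ℤ) - 1) ((n - 1) * (p + 1) + 1) <
        SplineApprox.bestConst p (-1) n := by
  have h1 := SplineApprox.isLeast_bestConst
    ⟨_, SplineApprox.mem_errorConstants_smooth p ((n - 1) * (p + 1) + 1)⟩
  have h2 := SplineApprox.isLeast_bestConst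
    ⟨_, SplineApprox.mem_errorConstants_discontinuous p n⟩
  refine ⟨h1, h2, ?_⟩
  refine (h1.2 (SplineApprox.mem_errorConstants_smooth p ((n - 1) * (p + 1) + 1))).trans_lt ?_
  refine lt_of_pow_lt_pow_left₀ 2 (SplineApprox.nonneg_of_mem_errorConstants h2.1) ?_
  refine lt_of_lt_of_le ?_ (SplineApprox.le_sq_of_mem_errorConstants h2.1)
  have hn : (0 : ℝ) < n := by exact_mod_cast Nat.pos_of_ne_zero (NeZero.ne n)
  have hm : (0 : ℝ) < (((n - 1) * (p + 1) + 1 : ℕ) : ℝ) := by positivity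
  have key := SplineApprox.factorial_ineq hpn
  set m : ℝ := (((n - 1) * (p + 1) + 1 : ℕ) : ℝ)
  have hpm : 0 < Real.pi * m := mul_pos Real.pi_pos hm
  rw [← pow_mul, mul_comm (p + 1) 2, one_div_pow, one_div_pow, mul_one_div, div_div,
    div_lt_div_iff₀ (by positivity) (by positivity), one_mul]
  exact key
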